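/- Let $\mathcal M=(\mathcal S,\mathcal A,P,r,H,\rho)$ be an episodic MDP with finite state space $\mathcal S$, finite action space $\mathcal A$, horizon $H$, transition probabilities $P_h(\cdot\mid s,a)$ ($h\in[H]=\{1,\dots,H\}$), rewards $r_h:\mathcal S\times\mathcal A\to[0,1]$ and initial distribution $\rho$. Let $\Pi$ be the set of non-stationary stochastic policies $\pi=(\pi_1,\dots,\pi_H)$, $\pi_h:\mathcal S\to\Delta(\mathcal A)$, and let $d^\pi_h(s,a)$ be the probability that $(s_h,a_h)=(s,a)$ under $\pi$ in $\mathcal M$. Let $\mathcal D$ be a dataset of $N\ge 1$ expert trajectories $(s_1,a_1,\dots,s_H,a_H)$, and let $\widehat{d^{\pi^{\mathrm E}}_h}(s,a)$ be the fraction of trajectories in $\mathcal D$ with $(s_h,a_h)=(s,a)$. The claim is deterministic and holds for every such dataset, whatever the expert. A policy $\bar\pi$ is an $\varepsilon$-optimal solution of TV-AIL if $$\sum_{h=1}^H\big\|d^{\bar\pi}_h-\widehat{d^{\pi^{\mathrm E}}_h}\big\|_1\le\min_{\pi\in\Pi}\sum_{h=1}^H\big\|d^{\pi}_h-\widehat{d^{\pi^{\mathrm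 E}}_h}\big\|_1+\varepsilon .$$ Let $\mathcal C_{\mathrm{TV}}$ be the set of families $c=(c_h)_{h\in[H]}$ of functions $c_h:\mathcal S\times\mathcal A\to[-1,1]$, and let $\mathcal P_{\mathcal C_{\mathrm{TV}}}$ be the Euclidean projection onto it. The gradient-based TV-AIL algorithm with $T$ iterations, step sizes $\eta^{(t)}$, optimization error $\varepsilon_{\mathrm{opt}}$ and an arbitrary initialization $c^{(1)}\in\mathcal C_{\mathrm{TV}}$ does the following for $t=1,\dots,T$: 1. it chooses any policy $\pi^{(t)}$ that is optimal in $\mathcal M$ for the reward function $-c^{(t)}$ up to an error $\varepsilon_{\mathrm{opt}}$ in policy value (the expected total reward over the $H$ steps); 2. it sets $c^{(t+1)}=\mathcal P_{\mathcal C_{\mathrm{TV}}}\big(c^{(t)}-\eta^{(t)}\nabla f^{(t)}(c^{(t)})\big)$, where $f^{(t)}(c)=\sum_{h=1}^H\sum_{(s,a)}c_h(s,a)\big(\widehat{d^{\pi^{\mathrm E}}_h}(s,a)-d^{\pi^{(t)}}_h(s,a)\big)$. With $\bar d_h(s,a)=\frac1T\sum_{t=1}^T d^{\pi^{(t)}}_h(s,a)$,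 it outputs a policy $\bar\pi$ with $\bar\pi_h(a\mid s)=\bar d_h(s,a)/\sum_{a'}\bar d_h(s,a')$ whenever the denominator is nonzero, and with $\bar\pi_h(\cdot\mid s)$ an arbitrary distribution otherwise. **Proposition.** There is a universal constant $C>0$ such that the following holds for all such $\mathcal M$ and $\mathcal D$ and every $\varepsilon\in(0,H)$. If $\varepsilon_{\mathrm{opt}}\le\varepsilon/2$, $T\ge C\,|\mathcal S||\mathcal A|H^2/\varepsilon^2$ and $\eta^{(t)}=\sqrt{|\mathcal S||\mathcal A|/(8T)}$ for all $t$, then every output $\bar\pi$ of the algorithm is an $\varepsilon$-optimal solution of TV-AIL. -/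

import Mathlib

namespace TVAIL

/-- A tabular episodic MDP with states `S`, actions `A` and horizon `H`. Time steps `1, …, H` are
indexed by `Fin H` (so from `0` to `H - 1`). -/
structure MDP (H : ℕ) (S A : Type*) [Fintype S] where
  /-- initial state distribution `ρ` -/
  init : stdSimplex ℝ S
  /-- `trans h s a` is the distribution `P_h(· | s, a)` of the next state -/
  trans : Fin H → S → A → stdSimplex ℝ S
  /-- reward function `r_h(s, a)` of the MDP -/
  reward : Fin H → S → A → ℝ
  reward_mem : ∀ h s a, reward h s a ∈ Set.Icc (0 : ℝ) 1

/-- Non-stationary stochastic policies: `π h s` is the distribution `π_h(· | s)` on actions. -/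
abbrev Policy (H : ℕ) (S A : Type*) [Fintype A] := Fin H → S → stdSimplex ℝ A

/-- Trajectories `(s_1, a_1, …, s_H, a_H)`. -/
abbrev Traj (H : ℕ) (S A : Type*) := Fin H → S × A

/-- Functions `c_h(s, a)`, as a Euclidean space indexed by `(h, s, a)`. -/
abbrev Cost (H : ℕ) (S A : Type*) [Fintype S] [Fintype A] := EuclideanSpace ℝ (Fin H × S × A)

section

variable {H N : ℕ} {S A : Type*} [Fintype S] [Fintype A]

/-- The probability with which the state of `τ` at step `h` is generated given the preceding
state-action pair: `ρ(s_1)` at the first step, and `P_{h-1}(s_h | s_{h-1}, a_{h-1})` afterwards. -/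
noncomputable def MDP.stateProb (M : MDP H S A) (τ : Traj H S A) (h : Fin H) : ℝ :=
  if h.val = 0 then M.init.1 (τ h).1
  else
    let k : Fin H := ⟨h.val - 1, lt_of_le_of_lt (Nat.sub_le _ _) h.isLt⟩
    (M.trans k (τ k).1 (τ k).2).1 (τ h).1

/-- The probability of the trajectory `τ` when the policy `π` is run in `M`. -/
noncomputable def MDP.trajProb (M : MDP H S A) (π : Policy H S A) (τ : Traj H S A) : ℝ :=
  ∏ h : Fin H, M.stateProb τ h * (π h (τ h).1).1 (τ h).2

/-- The policy value: expected total reward of `π` for the reward function `r`. -/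
noncomputable def MDP.value (M : MDP H S A) (r : Fin H → S → A → ℝ) (π : Policy H S A) : ℝ :=
  ∑ τ : Traj H S A, M.trajProb π τ * ∑ h : Fin H, r h (τ h).1 (τ h).2

/-- `π` is an optimal policy for the reward function `r`, up to an error of `δ`. -/
def MDP.IsApproxOptimalPolicy (M : MDP H S A) (r : Fin H → S → A → ℝ) (δ : ℝ)
    (π : Policy H S A) : Prop :=
  ∀ π' : Policy H S A, M.value r π' ≤ M.value r π + δ

variable [DecidableEq S] [DecidableEq A]

/-- The state-action distribution `d^π_h(s, a)`: the probability that `(s_h, a_h) = (s, a)`. -/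
noncomputable def MDP.occ (M : MDP H S A) (π : Policy H S A) (h : Fin H) (s : S) (a : A) : ℝ :=
  ∑ τ : Traj H S A with τ h = (s, a), M.trajProb π τ

/-- The empirical state-action distribution of a dataset of `N` trajectories: the fraction of the
trajectories that are at `(s, a)` in time step `h`. -/
noncomputable def empOcc (D : Fin N → Traj H S A) (h : Fin H) (s : S) (a : A) : ℝ :=
  ((Finset.univ.filter fun i : Fin N => D i h = (s, a)).card : ℝ) / (N : ℝ)

/-- The TV-AIL objective `∑_h ‖d^π_h - d̂_h‖₁`. -/
noncomputable def MDP.tvLoss (M : MDP H S A) (D : Fin N → Traj H S A) (π : Policy H S A) : ℝ :=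
  ∑ h : Fin H, ∑ s : S, ∑ a : A, |M.occ π h s a - empOcc D h s a|

/-- `π` is an `ε`-optimal solution of TV-AIL: its loss is at most the minimum of the loss over all
policies, plus `ε`. -/
def MDP.IsEpsOptimalTVAIL (M : MDP H S A) (D : Fin N → Traj H S A) (ε : ℝ)
    (π : Policy H S A) : Prop :=
  ∃ m : ℝ, IsLeast (Set.range (M.tvLoss D)) m ∧ M.tvLoss D π ≤ m + ε

/-- The set `C_TV` of discriminators, with values in `[-1, 1]`. -/
def discriminators (H : ℕ) (S A : Type*) [Fintype S] [Fintype A] : Set (Cost H S A) := {c | ∀ i, c i ∈ Set.Icc (-1 : ℝ) 1}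

/-- `z` is a Euclidean projection of `x` on the set `K`. -/
def IsProjection {E : Type*} [NormedAddCommGroup E] (K : Set E) (x z : E) : Prop :=
  z ∈ K ∧ ∀ w ∈ K, ‖z - x‖ ≤ ‖w - x‖

/-- The discriminator objective for the policy `π`:
`f(c) = ∑_h ∑_{(s,a)} c_h(s, a) (d̂_h(s, a) - d^π_h(s, a))`. -/
noncomputable def MDP.discObj (M : MDP H S A) (D : Fin N → Traj H S A) (π : Policy H S A)
    (c : Cost H S A) : ℝ :=
  ∑ h : Fin H, ∑ s : S, ∑ a : A, c (h, s, a) * (empOcc D h s a - M.occ π h s a)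

/-- The mean of the state-action distributions of the policies `π 1, …, π T`. -/
noncomputable def MDP.meanOcc (M : MDP H S A) (T : ℕ) (π : ℕ → Policy H S A)
    (h : Fin H) (s : S) (a : A) : ℝ :=
  (∑ t ∈ Finset.Icc 1 T, M.occ (π t) h s a) / (T : ℝ)

/-- `c` (discriminators), `π` (policies) and `out` (output policy) form a run of the gradient-based
TV-AIL algorithm on the dataset `D` with `T` iterations, step sizes `η` and policy optimization
error `εopt`. The initialization `c 1` is any discriminator. -/
structure MDP.IsTVAILRun (M : MDP H S A) (D : Fin N → Traj H S A) (T : ℕ) (η : ℕ → ℝ) (εopt : ℝ)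
    (c : ℕ → Cost H S A) (π : ℕ → Policy H S A) (out : Policy H S A) : Prop where
  init_mem : c 1 ∈ discriminators H S A
  policy_step : ∀ t ∈ Finset.Icc 1 T,
    M.IsApproxOptimalPolicy (fun h s a => -(c t (h, s, a))) εopt (π t)
  disc_step : ∀ t ∈ Finset.Icc 1 T,
    IsProjection (discriminators H S A)
      (c t - η t • gradient (M.discObj D (π t)) (c t)) (c (t + 1))
  /-- The output is the conditional distribution of the mean state-action distribution. It is
  arbitrary at states of mean probability `0`, where the quotient is undefined. -/
  output : ∀ h s a, (∑ a' : A, M.meanOcc T π h s a') ≠ 0 →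
    (out h s).1 a = M.meanOcc T π h s a / ∑ a' : A, M.meanOcc T π h s a'

end

end TVAIL

/-!
The algorithm plays a zero-sum game between policies and discriminators. By `ℓ¹`-`ℓ∞` duality the
TV-AIL loss of `π` is the maximum of `-f_π` over the discriminators, and an approximate best
response to a discriminator has payoff at most the minimal loss, up to `εopt`. The discriminators
play projected online gradient descent, so their average payoff is that of the best fixed
discriminator, up to the average regret. The occupancy measures of `M` are cut out by the linear
Bellman flow equations and determined by any of their conditional policies; hence the average of
the occupancy measures of the iterates is the occupancy measure of the output policy, and the payoff
of the best fixed discriminator is the loss of the output.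
-/

namespace TVAIL

open Finset

section PathMarginal

variable {X R : Type*} [CommSemiring R] {n : ℕ}

/-- The weight of the path `τ` of an inhomogeneous Markov chain with initial weights `p` and
transition kernels `K`. -/
def pathWeight (p : X → R) (K : Fin n → X → X → R) (τ : Fin (n + 1) → X) : R :=
  p (τ 0) * ∏ i, K i (τ i.castSucc) (τ i.succ)

variable [Fintype X]

theorem sum_fin_cons {α : Fin (n + 1) → Type*} [∀ i, Fintype (α i)] {G : Type*} [AddCommMonoid G]
    (f : (∀ i, α i) → G) :
    ∑ τ, f τ = ∑ τ : ∀ i : Fin n, α i.succ, ∑ x, f (Fin.cons x τ) := by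
  rw [← (Fin.consEquiv α).sum_comp, Fintype.sum_prod_type, sum_comm]
  rfl

theorem sum_pathWeight_cons (p : X → R) (K : Fin (n + 1) → X → X → R) (τ : Fin (n + 1) → X) :
    ∑ x, pathWeight p K (Fin.cons x τ) =
      pathWeight (fun y => ∑ x, p x * K 0 x y) (fun i => K i.succ) τ := by
  simp only [pathWeight, Fin.prod_univ_succ, sum_mul, Fin.cons_zero, Fin.cons_succ,
    Fin.castSucc_zero, ← Fin.succ_castSucc, mul_assoc]

theorem sum_pathWeight (p : X → R) {K : Fin n → X → X → R} (hK : ∀ i x, ∑ y, K i x y = 1) :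
    ∑ τ, pathWeight p K τ = ∑ x, p x := by
  induction n generalizing p with
  | zero =>
    rw [sum_fin_cons]
    simp [pathWeight]
  | succ n ih =>
    rw [sum_fin_cons]
    simp_rw [sum_pathWeight_cons]
    rw [ih _ fun i => hK i.succ, sum_comm]
    simp_rw [← mul_sum, hK, mul_one]

variable [DecidableEq X]

/-- The total weight of the paths that are at `x` in step `h`. -/
def pathMarginal (p : X → R) (K : Fin n → X → X → R) (h : Fin (n + 1)) (x : X) : R :=
  ∑ τ : Fin (n + 1) → X with τ h = x, pathWeight p K τ

theorem pathMarginal_zero (p : X → R) {K : Fin n → X → X → R} (hK : ∀ i x, ∑ y, K i x y = 1)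
    (x : X) : pathMarginal p K 0 x = p x := by
  calc pathMarginal p K 0 x = ∑ τ, pathWeight (fun z => if z = x then p z else 0) K τ := by
        simp only [pathMarginal, pathWeight, sum_filter, ite_mul, zero_mul]
    _ = p x := by simp [sum_pathWeight _ hK]

theorem pathMarginal_succ_eq_pathMarginal (p : X → R) (K : Fin (n + 1) → X → X → R)
    (h : Fin (n + 1)) :
    pathMarginal p K h.succ =
      pathMarginal (fun y => ∑ x, p x * K 0 x y) (fun i => K i.succ) h := by
  funext y
  simp only [pathMarginal, sum_filter]
  rw [sum_fin_cons]
  refine sum_congr rfl fun τ _ => ?_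
  simp only [Fin.cons_succ, ← sum_pathWeight_cons]
  split_ifs <;> simp

theorem pathMarginal_succ (p : X → R) {K : Fin n → X → X → R} (hK : ∀ i x, ∑ y, K i x y = 1)
    (i : Fin n) (y : X) :
    pathMarginal p K i.succ y = ∑ x, pathMarginal p K i.castSucc x * K i x y := by
  induction n generalizing p with
  | zero => exact i.elim0
  | succ n ih =>
    rw [pathMarginal_succ_eq_pathMarginal]
    induction i using Fin.cases with
    | zero => simp only [Fin.castSucc_zero, pathMarginal_zero _ hK,
        pathMarginal_zero _ fun i => hK i.succ]
    | succ i =>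
      rw [ih _ fun i => hK i.succ, ← Fin.succ_castSucc, pathMarginal_succ_eq_pathMarginal]

end PathMarginal

section Conditional

variable {H : ℕ} {S A : Type*} [Fintype A]

/-- The policy `π` disintegrates the family `d` of weights on state-action pairs along the states.
The equation is multiplicative, so `π` is arbitrary at the states of weight `0`. -/
def Policy.IsConditionalOf (π : Policy H S A) (d : Fin H → S → A → ℝ) : Prop :=
  ∀ h s a, d h s a = (∑ a', d h s a') * (π h s).1 a

theorem Policy.isConditionalOf_of_eq_div {π : Policy H S A} {d : Fin H → S → A → ℝ}
    (hd : ∀ h s a, 0 ≤ d h s a)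
    (hπ : ∀ h s a, (∑ a', d h s a') ≠ 0 → (π h s).1 a = d h s a / ∑ a', d h s a') :
    π.IsConditionalOf d := by
  intro h s a
  by_cases hs : ∑ a', d h s a' = 0
  · rw [hs, zero_mul]
    exact (sum_eq_zero_iff_of_nonneg fun a _ => hd h s a).1 hs a (mem_univ a)
  · rw [hπ h s a hs, mul_div_cancel₀ _ hs]

end Conditional

namespace MDP

section OccupancyPolytope

variable {n : ℕ} {S A : Type*} [Fintype S] [Fintype A]

/-- The polytope of state-action occupancy measures, cut out by the Bellman flow equations. -/
def occupancyPolytope (M : MDP (n + 1) S A) : Set (Fin (n + 1) → S → A → ℝ) :=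
  {d | (∀ h s a, 0 ≤ d h s a) ∧ (∀ s, ∑ a, d 0 s a = M.init.1 s) ∧
    ∀ (i : Fin n) s, ∑ a, d i.succ s a =
      ∑ s', ∑ a', d i.castSucc s' a' * (M.trans i.castSucc s' a').1 s}

theorem convex_occupancyPolytope (M : MDP (n + 1) S A) : Convex ℝ M.occupancyPolytope := by
  rintro d ⟨hd, hd_zero, hd_succ⟩ e ⟨he, he_zero, he_succ⟩ a b ha hb hab
  refine ⟨fun h s x => ?_, fun s => ?_, fun i s => ?_⟩
  · exact add_nonneg (mul_nonneg ha (hd h s x)) (mul_nonneg hb (he h s x))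
  · simp only [Pi.add_apply, Pi.smul_apply, smul_eq_mul, sum_add_distrib, ← mul_sum, hd_zero,
      he_zero, ← add_mul, hab, one_mul]
  · simp only [Pi.add_apply, Pi.smul_apply, smul_eq_mul, sum_add_distrib, ← mul_sum, add_mul,
      mul_assoc, hd_succ, he_succ]

theorem eq_of_isConditionalOf {M : MDP (n + 1) S A} {d e : Fin (n + 1) → S → A → ℝ}
    (hd : d ∈ M.occupancyPolytope) (he : e ∈ M.occupancyPolytope) {π : Policy (n + 1) S A}
    (hπd : π.IsConditionalOf d) (hπe : π.IsConditionalOf e) : d = e := by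
  obtain ⟨-, hd_zero, hd_succ⟩ := hd
  obtain ⟨-, he_zero, he_succ⟩ := he
  funext h
  induction h using Fin.induction with
  | zero =>
    funext s a
    rw [hπd, hπe, hd_zero, he_zero]
  | succ i ih =>
    funext s a
    rw [hπd, hπe, hd_succ, he_succ, ih]

end OccupancyPolytope

section Occupancy

variable {H n : ℕ} {S A : Type*} [Fintype S] [Fintype A]

theorem trajProb_nonneg (M : MDP H S A) (π : Policy H S A) (τ : Traj H S A) :
    0 ≤ M.trajProb π τ := by
  refine prod_nonneg fun h _ => mul_nonneg ?_ ((π h _).2.1 _)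
  unfold stateProb
  split_ifs
  · exact M.init.2.1 _
  · exact (M.trans _ _ _).2.1 _

/-- The distribution of the first state-action pair under the policy `π`. -/
noncomputable def initWeight (M : MDP (n + 1) S A) (π : Policy (n + 1) S A) (x : S × A) : ℝ :=
  M.init.1 x.1 * (π 0 x.1).1 x.2

/-- The transition kernel of the Markov chain of state-action pairs under the policy `π`. -/
noncomputable def kernel (M : MDP (n + 1) S A) (π : Policy (n + 1) S A) (i : Fin n)
    (x y : S × A) : ℝ :=
  (M.trans i.castSucc x.1 x.2).1 y.1 * (π i.succ y.1).1 y.2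

theorem sum_initWeight (M : MDP (n + 1) S A) (π : Policy (n + 1) S A) :
    ∑ x, M.initWeight π x = 1 := by
  simp only [initWeight, Fintype.sum_prod_type, ← mul_sum, (π _ _).2.2, mul_one, M.init.2.2]

theorem sum_kernel (M : MDP (n + 1) S A) (π : Policy (n + 1) S A) (i : Fin n) (x : S × A) :
    ∑ y, M.kernel π i x y = 1 := by
  simp only [kernel, Fintype.sum_prod_type, ← mul_sum, (π _ _).2.2, mul_one, (M.trans _ _ _).2.2]

theorem trajProb_eq_pathWeight (M : MDP (n + 1) S A) (π : Policy (n + 1) S A) :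
    M.trajProb π = pathWeight (M.initWeight π) (M.kernel π) := by
  funext τ
  rw [trajProb, pathWeight, Fin.prod_univ_succ]
  rfl

variable [DecidableEq S] [DecidableEq A]

theorem occ_eq_pathMarginal (M : MDP (n + 1) S A) (π : Policy (n + 1) S A) (h : Fin (n + 1))
    (s : S) (a : A) :
    M.occ π h s a = pathMarginal (M.initWeight π) (M.kernel π) h (s, a) := by
  rw [occ, trajProb_eq_pathWeight, pathMarginal]

theorem occ_zero (M : MDP (n + 1) S A) (π : Policy (n + 1) S A) (s : S) (a : A) :
    M.occ π 0 s a = M.init.1 s * (π 0 s).1 a := by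
  rw [occ_eq_pathMarginal, pathMarginal_zero _ (M.sum_kernel π), initWeight]

theorem occ_succ (M : MDP (n + 1) S A) (π : Policy (n + 1) S A) (i : Fin n) (s : S) (a : A) :
    M.occ π i.succ s a = (∑ s', ∑ a', M.occ π i.castSucc s' a' *
      (M.trans i.castSucc s' a').1 s) * (π i.succ s).1 a := by
  rw [occ_eq_pathMarginal, pathMarginal_succ _ (M.sum_kernel π)]
  simp only [occ_eq_pathMarginal, kernel, Fintype.sum_prod_type, sum_mul, mul_assoc]

theorem occ_mem_occupancyPolytope (M : MDP (n + 1) S A) (π : Policy (n + 1) S A) :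
    M.occ π ∈ M.occupancyPolytope := by
  refine ⟨fun h s a => sum_nonneg fun τ _ => M.trajProb_nonneg π τ, fun s => ?_, fun i s => ?_⟩
  · simp_rw [occ_zero, ← mul_sum, (π _ _).2.2, mul_one]
  · simp_rw [occ_succ, ← mul_sum, (π _ _).2.2, mul_one]

theorem isConditionalOf_occ (M : MDP (n + 1) S A) (π : Policy (n + 1) S A) :
    π.IsConditionalOf (M.occ π) := by
  intro h s a
  cases h using Fin.cases with
  | zero => simp_rw [occ_zero, ← mul_sum, (π _ _).2.2, mul_one]
  | succ i => simp_rw [occ_succ, ← mul_sum, (π _ _).2.2, mul_one]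

theorem meanOcc_mem_occupancyPolytope (M : MDP (n + 1) S A) {T : ℕ} (hT : 0 < T)
    (π : ℕ → Policy (n + 1) S A) : M.meanOcc T π ∈ M.occupancyPolytope := by
  have h_mean : M.meanOcc T π = ∑ t ∈ Icc 1 T, (T : ℝ)⁻¹ • M.occ (π t) := by
    funext h s a
    simp only [meanOcc, Finset.sum_apply, Pi.smul_apply, smul_eq_mul, ← mul_sum, div_eq_inv_mul]
  rw [h_mean]
  refine M.convex_occupancyPolytope.sum_mem (fun t _ => by positivity) ?_
    fun t _ => M.occ_mem_occupancyPolytope (π t)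
  simp [hT.ne']

theorem occ_eq_meanOcc (M : MDP H S A) {T : ℕ} (hT : 0 < T) {π : ℕ → Policy H S A}
    {out : Policy H S A}
    (hout : ∀ h s a, (∑ a', M.meanOcc T π h s a') ≠ 0 →
      (out h s).1 a = M.meanOcc T π h s a / ∑ a', M.meanOcc T π h s a') :
    M.occ out = M.meanOcc T π := by
  obtain _ | n := H
  · exact funext fun h => h.elim0
  have h_mean := M.meanOcc_mem_occupancyPolytope hT π
  exact eq_of_isConditionalOf (M.occ_mem_occupancyPolytope out) h_mean (M.isConditionalOf_occ out)
    (Policy.isConditionalOf_of_eq_div h_mean.1 hout)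

theorem occ_mem_stdSimplex (M : MDP H S A) (π : Policy H S A) (h : Fin H) :
    (fun x : S × A => M.occ π h x.1 x.2) ∈ stdSimplex ℝ (S × A) := by
  refine ⟨fun x => sum_nonneg fun τ _ => M.trajProb_nonneg π τ, ?_⟩
  obtain _ | n := H
  · exact h.elim0
  calc ∑ x : S × A, M.occ π h x.1 x.2 = ∑ τ, M.trajProb π τ :=
        sum_fiberwise univ (fun τ : Traj (n + 1) S A => τ h) (M.trajProb π)
    _ = 1 := by
        rw [trajProb_eq_pathWeight, sum_pathWeight _ (M.sum_kernel π), sum_initWeight]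

theorem sum_trajProb_mul (M : MDP H S A) (π : Policy H S A) (h : Fin H) (F : S × A → ℝ) :
    ∑ τ, M.trajProb π τ * F (τ h) = ∑ x : S × A, M.occ π h x.1 x.2 * F x := by
  rw [← sum_fiberwise univ fun τ : Traj H S A => τ h]
  refine sum_congr rfl fun x _ => ?_
  rw [occ, sum_mul]
  refine sum_congr rfl fun τ hτ => ?_
  rw [(mem_filter.1 hτ).2]

theorem value_eq_sum_occ (M : MDP H S A) (r : Fin H → S → A → ℝ) (π : Policy H S A) :
    M.value r π = ∑ h, ∑ s, ∑ a, r h s a * M.occ π h s a := by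
  simp_rw [value, mul_sum]
  rw [sum_comm]
  refine sum_congr rfl fun h _ => ?_
  rw [M.sum_trajProb_mul π h fun x => r h x.1 x.2, Fintype.sum_prod_type]
  simp_rw [mul_comm]

end Occupancy

section Minimum

variable {H N : ℕ} {S A : Type*} [Fintype S] [Fintype A] [DecidableEq S] [DecidableEq A]

theorem continuous_occ (M : MDP H S A) (h : Fin H) (s : S) (a : A) :
    Continuous fun π : Policy H S A => M.occ π h s a := by
  have h_action (k : Fin H) (s : S) (a : A) : Continuous fun π : Policy H S A => (π k s).1 a :=
    (continuous_apply a).comp (continuous_subtype_val.comp (continuous_apply_apply k s))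
  exact continuous_finsetSum _ fun τ _ => continuous_finsetProd _ fun k _ =>
    (h_action k _ _).const_mul _

theorem continuous_tvLoss (M : MDP H S A) (D : Fin N → Traj H S A) : Continuous (M.tvLoss D) := by
  have := M.continuous_occ
  unfold tvLoss
  fun_prop

theorem exists_isLeast_tvLoss [Nonempty (Policy H S A)] (M : MDP H S A) (D : Fin N → Traj H S A) :
    ∃ m, IsLeast (Set.range (M.tvLoss D)) m :=
  (isCompact_range (M.continuous_tvLoss D)).exists_isLeast (Set.range_nonempty _)

end Minimum

end MDP

section Simplex

variable {ι : Type*} [Fintype ι] {p q : ι → ℝ}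

theorem nonempty_of_mem_stdSimplex (hp : p ∈ stdSimplex ℝ ι) : Nonempty ι := by
  by_contra h_empty
  rw [not_nonempty_iff] at h_empty
  simp [stdSimplex_of_isEmpty_index] at hp

theorem sum_sq_sub_le_two (hp : p ∈ stdSimplex ℝ ι) (hq : q ∈ stdSimplex ℝ ι) :
    ∑ i, (p i - q i) ^ 2 ≤ 2 := by
  calc ∑ i, (p i - q i) ^ 2 ≤ ∑ i, (p i + q i) := by
        refine sum_le_sum fun i _ => ?_
        obtain ⟨hp₀, hp₁⟩ := mem_Icc_of_mem_stdSimplex hp i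
        obtain ⟨hq₀, hq₁⟩ := mem_Icc_of_mem_stdSimplex hq i
        nlinarith
    _ = 2 := by rw [sum_add_distrib, hp.2, hq.2, one_add_one_eq_two]

end Simplex

theorem empOcc_mem_stdSimplex {H N : ℕ} {S A : Type*} [Fintype S] [Fintype A] [DecidableEq S]
    [DecidableEq A] (D : Fin N → Traj H S A) (hN : 0 < N) (h : Fin H) :
    (fun x : S × A => empOcc D h x.1 x.2) ∈ stdSimplex ℝ (S × A) := by
  refine ⟨fun x => by unfold empOcc; positivity, ?_⟩
  have h_card : ∑ x : S × A, #{i | D i h = x} = N := by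
    simpa using (card_eq_sum_card_fiberwise (s := univ) (t := univ) (f := fun i => D i h)
      (by simp [Set.MapsTo])).symm
  simp only [empOcc, ← sum_div]
  rw [div_eq_one_iff_eq (by positivity)]
  exact_mod_cast h_card

section ProjectedGradientDescent

variable {E : Type*} [NormedAddCommGroup E] [InnerProductSpace ℝ E] {K : Set E}

theorem IsProjection.inner_sub_sub_nonpos (hK : Convex ℝ K) {x z w : E} (hz : IsProjection K x z)
    (hw : w ∈ K) : inner ℝ (x - z) (w - z) ≤ 0 := by
  refine (norm_eq_iInf_iff_real_inner_le_zero hK hz.1).1 ?_ w hw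
  have : Nonempty K := ⟨⟨w, hw⟩⟩
  refine le_antisymm (le_ciInf fun v => ?_)
    (ciInf_le ⟨0, Set.forall_mem_range.2 fun v => norm_nonneg _⟩ (⟨z, hz.1⟩ : K))
  rw [norm_sub_rev, norm_sub_rev x]
  exact hz.2 v v.2

theorem IsProjection.norm_sub_sq_le (hK : Convex ℝ K) {x z w : E} (hz : IsProjection K x z)
    (hw : w ∈ K) : ‖z - w‖ ^ 2 ≤ ‖x - w‖ ^ 2 := by
  have h_inner := hz.inner_sub_sub_nonpos hK hw
  have h_expand : ‖x - w‖ ^ 2 =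
      ‖x - z‖ ^ 2 - 2 * inner ℝ (x - z) (w - z) + ‖z - w‖ ^ 2 := by
    rw [← sub_sub_sub_cancel_right x w z, norm_sub_sq_real, norm_sub_rev w z]
  nlinarith [sq_nonneg ‖x - z‖]

theorem sum_inner_sub_le_of_isProjection (hK : Convex ℝ K) {z g : ℕ → E} {η : ℕ → ℝ} {T : ℕ}
    (hz : ∀ t ∈ Icc 1 T, IsProjection K (z t - η t • g t) (z (t + 1))) {w : E} (hw : w ∈ K) :
    ∑ t ∈ Icc 1 T, 2 * η t * inner ℝ (g t) (z t - w) ≤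
      ‖z 1 - w‖ ^ 2 + ∑ t ∈ Icc 1 T, η t ^ 2 * ‖g t‖ ^ 2 := by
  have h_step (t) (ht : t ∈ Icc 1 T) :
      2 * η t * inner ℝ (g t) (z t - w) + (‖z (t + 1) - w‖ ^ 2 - ‖z t - w‖ ^ 2) ≤
        η t ^ 2 * ‖g t‖ ^ 2 := by
    have h_proj := (hz t ht).norm_sub_sq_le hK hw
    rw [sub_right_comm, norm_sub_sq_real (z t - w), norm_smul, mul_pow, Real.norm_eq_abs, sq_abs,
      inner_smul_right, real_inner_comm] at h_proj
    linarith
  have h_telescope : ∑ t ∈ Icc 1 T, (‖z (t + 1) - w‖ ^ 2 - ‖z t - w‖ ^ 2) =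
      ‖z (T + 1) - w‖ ^ 2 - ‖z 1 - w‖ ^ 2 := by
    rw [← Ico_add_one_right_eq_Icc, sum_Ico_sub (fun t => ‖z t - w‖ ^ 2) (Nat.le_add_left 1 T)]
  have h_sum := sum_le_sum h_step
  rw [sum_add_distrib, h_telescope] at h_sum
  linarith [sq_nonneg ‖z (T + 1) - w‖]

end ProjectedGradientDescent

section Discriminators

variable {H : ℕ} {S A : Type*} [Fintype S] [Fintype A]

theorem convex_discriminators : Convex ℝ (discriminators H S A) :=
  fun _ hx _ hy _ _ ha hb hab i => convex_Icc (-1 : ℝ) 1 (hx i) (hy i) ha hb hab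

theorem norm_sub_sq_le_of_mem_discriminators {c w : Cost H S A} (hc : c ∈ discriminators H S A)
    (hw : w ∈ discriminators H S A) :
    ‖c - w‖ ^ 2 ≤ 4 * (H * (Fintype.card S * Fintype.card A)) := by
  rw [EuclideanSpace.real_norm_sq_eq]
  calc ∑ i, (c - w) i ^ 2 ≤ ∑ _i : Fin H × S × A, (4 : ℝ) := by
        refine sum_le_sum fun i _ => ?_
        rw [PiLp.sub_apply]
        obtain ⟨hc₁, hc₂⟩ := hc i
        obtain ⟨hw₁, hw₂⟩ := hw i
        nlinarith
    _ = 4 * (H * (Fintype.card S * Fintype.card A)) := by simp [mul_comm]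

end Discriminators

namespace MDP

section DiscriminatorObjective

variable {H N T : ℕ} {S A : Type*} [Fintype S] [Fintype A] [DecidableEq S] [DecidableEq A]

/-- The gradient of the linear function `M.discObj D π`. -/
noncomputable def discGrad (M : MDP H S A) (D : Fin N → Traj H S A) (π : Policy H S A) :
    Cost H S A :=
  WithLp.toLp 2 fun i => empOcc D i.1 i.2.1 i.2.2 - M.occ π i.1 i.2.1 i.2.2

theorem discObj_eq_inner (M : MDP H S A) (D : Fin N → Traj H S A) (π : Policy H S A)
    (c : Cost H S A) : M.discObj D π c = inner ℝ (M.discGrad D π) c := by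
  simp [discObj, discGrad, PiLp.inner_apply, Fintype.sum_prod_type]

theorem gradient_discObj (M : MDP H S A) (D : Fin N → Traj H S A) (π : Policy H S A)
    (c : Cost H S A) : gradient (M.discObj D π) c = M.discGrad D π := by
  have h_dual : M.discObj D π = InnerProductSpace.toDual ℝ (Cost H S A) (M.discGrad D π) := by
    funext c
    rw [discObj_eq_inner, InnerProductSpace.toDual_apply_apply]
  rw [h_dual]
  exact (ContinuousLinearMap.hasFDerivAt _).hasGradientAt.gradient.trans (by simp)

theorem norm_discGrad_sq_le (M : MDP H S A) (D : Fin N → Traj H S A) (hN : 0 < N)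
    (π : Policy H S A) : ‖M.discGrad D π‖ ^ 2 ≤ 2 * H := by
  rw [EuclideanSpace.real_norm_sq_eq, Fintype.sum_prod_type]
  calc ∑ h, ∑ x, M.discGrad D π (h, x) ^ 2 ≤ ∑ _h : Fin H, (2 : ℝ) :=
        sum_le_sum fun h _ =>
          sum_sq_sub_le_two (empOcc_mem_stdSimplex D hN h) (M.occ_mem_stdSimplex π h)
    _ = 2 * H := by simp [mul_comm]

theorem isGreatest_tvLoss (M : MDP H S A) (D : Fin N → Traj H S A) (π : Policy H S A) :
    IsGreatest ((fun c => -M.discObj D π c) '' discriminators H S A) (M.tvLoss D π) := by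
  have h_neg (c : Cost H S A) : -M.discObj D π c =
      ∑ h, ∑ s, ∑ a, c (h, s, a) * (M.occ π h s a - empOcc D h s a) := by
    simp only [discObj, ← sum_neg_distrib, ← mul_neg, neg_sub]
  constructor
  · refine ⟨WithLp.toLp 2 fun i =>
      (SignType.sign (M.occ π i.1 i.2.1 i.2.2 - empOcc D i.1 i.2.1 i.2.2) : ℝ), fun i => ?_, ?_⟩
    · change (SignType.sign (M.occ π i.1 i.2.1 i.2.2 - empOcc D i.1 i.2.1 i.2.2) : ℝ) ∈ _
      cases SignType.sign (M.occ π i.1 i.2.1 i.2.2 - empOcc D i.1 i.2.1 i.2.2) <;> norm_num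
    · simp only [h_neg, sign_mul_self, tvLoss]
  · rintro _ ⟨c, hc, rfl⟩
    simp only [h_neg]
    refine sum_le_sum fun h _ => sum_le_sum fun s _ => sum_le_sum fun a _ => ?_
    refine (le_abs_self _).trans ?_
    rw [abs_mul]
    exact mul_le_of_le_one_left (abs_nonneg _) (abs_le.2 (hc _))

theorem sum_discObj_eq_mul (M : MDP H S A) (D : Fin N → Traj H S A) (hT : 0 < T)
    {π : ℕ → Policy H S A} {π' : Policy H S A} (h_occ : M.occ π' = M.meanOcc T π)
    (c : Cost H S A) : ∑ t ∈ Icc 1 T, M.discObj D (π t) c = T * M.discObj D π' c := by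
  have h_grad : ∑ t ∈ Icc 1 T, M.discGrad D (π t) = (T : ℝ) • M.discGrad D π' := by
    ext ⟨h, s, a⟩
    have hT' : (T : ℝ) ≠ 0 := by positivity
    simp [discGrad, h_occ, meanOcc, mul_sub, mul_div_cancel₀ _ hT']
  simp_rw [discObj_eq_inner]
  rw [← sum_inner, h_grad, real_inner_smul_left]

theorem IsApproxOptimalPolicy.neg_discObj_le {M : MDP H S A} {δ : ℝ} {π : Policy H S A}
    {c : Cost H S A} (hπ : M.IsApproxOptimalPolicy (fun h s a => -(c (h, s, a))) δ π)
    (D : Fin N → Traj H S A) (π' : Policy H S A) :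
    -M.discObj D π c ≤ -M.discObj D π' c + δ := by
  have h_value := hπ π'
  simp only [value_eq_sum_occ, neg_mul, sum_neg_distrib] at h_value
  simp only [discObj, mul_sub, sum_sub_distrib]
  linarith

end DiscriminatorObjective

namespace IsTVAILRun

variable {H N T : ℕ} {S A : Type*} [Fintype S] [Fintype A] [DecidableEq S] [DecidableEq A]
  {M : MDP H S A} {D : Fin N → Traj H S A} {δ : ℝ} {c : ℕ → Cost H S A}
  {π : ℕ → Policy H S A} {out : Policy H S A}

theorem mem_discriminators {η : ℕ → ℝ} (hrun : M.IsTVAILRun D T η δ c π out) {t : ℕ}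
    (ht : t ∈ Icc 1 T) : c t ∈ discriminators H S A := by
  obtain _ | _ | t := t
  · simp at ht
  · exact hrun.init_mem
  · exact (hrun.disc_step (t + 1) (by simp only [mem_Icc] at ht ⊢; omega)).1

theorem regret_le {η : ℕ → ℝ} (hrun : M.IsTVAILRun D T η δ c π out) (hN : 0 < N)
    {w : Cost H S A} (hw : w ∈ discriminators H S A) :
    ∑ t ∈ Icc 1 T, 2 * η t * (M.discObj D (π t) (c t) - M.discObj D (π t) w) ≤
      4 * (H * (Fintype.card S * Fintype.card A)) + ∑ t ∈ Icc 1 T, η t ^ 2 * (2 * H) := by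
  have h_descent := sum_inner_sub_le_of_isProjection convex_discriminators
    (g := fun t => M.discGrad D (π t)) (fun t ht => by
      simpa only [gradient_discObj] using hrun.disc_step t ht) hw
  simp only [inner_sub_right, ← discObj_eq_inner] at h_descent
  refine h_descent.trans (add_le_add ?_ (sum_le_sum fun t _ => ?_))
  · exact norm_sub_sq_le_of_mem_discriminators hrun.init_mem hw
  · exact mul_le_mul_of_nonneg_left (M.norm_discGrad_sq_le D hN (π t)) (sq_nonneg _)

theorem neg_discObj_le_tvLoss_add {η : ℕ → ℝ} (hrun : M.IsTVAILRun D T η δ c π out)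
    (π' : Policy H S A) {t : ℕ} (ht : t ∈ Icc 1 T) :
    -M.discObj D (π t) (c t) ≤ M.tvLoss D π' + δ :=
  calc -M.discObj D (π t) (c t) ≤ -M.discObj D π' (c t) + δ :=
        (hrun.policy_step t ht).neg_discObj_le D π'
    _ ≤ M.tvLoss D π' + δ := by
        gcongr
        exact (M.isGreatest_tvLoss D π').2 ⟨c t, hrun.mem_discriminators ht, rfl⟩

theorem tvLoss_le {η : ℝ} (hrun : M.IsTVAILRun D T (fun _ => η) δ c π out) (hN : 0 < N)
    (hT : 0 < T) (hη : 0 < η) (π' : Policy H S A) :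
    M.tvLoss D out ≤ M.tvLoss D π' + δ +
      (2 * (H * (Fintype.card S * Fintype.card A)) / (η * T) + η * H) := by
  obtain ⟨w, hw, hw_loss : -M.discObj D out w = M.tvLoss D out⟩ := (M.isGreatest_tvLoss D out).1
  have h_mean := M.sum_discObj_eq_mul D hT (M.occ_eq_meanOcc hT hrun.output) w
  have h_best : ∑ t ∈ Icc 1 T, -M.discObj D (π t) (c t) ≤ T * (M.tvLoss D π' + δ) := by
    simpa only [Nat.card_Icc, Nat.add_sub_cancel, nsmul_eq_mul] using
      sum_le_card_nsmul _ _ _ fun t => hrun.neg_discObj_le_tvLoss_add π'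
  have h_regret : ∑ t ∈ Icc 1 T, M.discObj D (π t) (c t) - ∑ t ∈ Icc 1 T, M.discObj D (π t) w ≤
      T * (2 * (H * (Fintype.card S * Fintype.card A)) / (η * T) + η * H) := by
    have h_sum := hrun.regret_le hN hw
    simp only [← mul_sum, sum_sub_distrib, sum_const, Nat.card_Icc, Nat.add_sub_cancel,
      nsmul_eq_mul] at h_sum
    refine le_of_mul_le_mul_left (h_sum.trans_eq ?_) (by positivity : 0 < 2 * η)
    field_simp
    ring
  rw [sum_neg_distrib] at h_best
  refine le_of_mul_le_mul_left ?_ (Nat.cast_pos.2 hT : (0 : ℝ) < T)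
  calc T * M.tvLoss D out
      = -∑ t ∈ Icc 1 T, M.discObj D (π t) (c t) + (∑ t ∈ Icc 1 T, M.discObj D (π t) (c t) -
          ∑ t ∈ Icc 1 T, M.discObj D (π t) w) := by rw [h_mean, ← hw_loss]; ring
    _ ≤ T * (M.tvLoss D π' + δ) +
          T * (2 * (H * (Fintype.card S * Fintype.card A)) / (η * T) + η * H) :=
        add_le_add h_best h_regret
    _ = T * (M.tvLoss D π' + δ +
          (2 * (H * (Fintype.card S * Fintype.card A)) / (η * T) + η * H)) := by rw [← mul_add]

end IsTVAILRun

end MDP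

theorem average_regret_bound_le {n H T ε : ℝ} (hn : 0 < n) (hH : 0 < H) (hT : 0 < T) (hε : 0 < ε)
    (h : 289 / 2 * (n * H ^ 2 / ε ^ 2) ≤ T) :
    2 * (H * n) / (√(n / (8 * T)) * T) + √(n / (8 * T)) * H ≤ ε / 2 := by
  set η := √(n / (8 * T))
  have hη : 0 < η := Real.sqrt_pos.2 (by positivity)
  have h_sq : η ^ 2 = n / (8 * T) := Real.sq_sqrt (by positivity)
  -- The constant `289 / 2 = 17 ^ 2 / 2` comes from the factor `17` in this rate.
  have h_sum : 2 * (H * n) / (η * T) + η * H = 17 * H * η := by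
    have hn_eq : n = 8 * T * η ^ 2 := by rw [h_sq]; field_simp
    rw [hn_eq]
    field_simp
    ring
  have hη_le : 17 * H * η ≤ ε / 2 := by
    refine le_of_sq_le_sq ?_ (by positivity)
    rw [mul_pow, h_sq]
    field_simp at h ⊢
    linarith
  exact h_sum.trans_le hη_le

end TVAIL

theorem mainTheorem9_general {S A : Type*} [Fintype S] [Fintype A] [DecidableEq S] [DecidableEq A]
    {H N T : ℕ} {M : TVAIL.MDP H S A} {D : Fin N → TVAIL.Traj H S A} {ε εopt : ℝ}
    {c : ℕ → TVAIL.Cost H S A} {π : ℕ → TVAIL.Policy H S A} {out : TVAIL.Policy H S A}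
    (hN : 0 < N) (hε : 0 < ε) (hopt : εopt ≤ ε / 2)
    (hT : 289 / 2 * ((Fintype.card S : ℝ) * (Fintype.card A : ℝ) * (H : ℝ) ^ 2 / ε ^ 2) ≤ (T : ℝ))
    (hrun : M.IsTVAILRun D T
      (fun _ => √((Fintype.card S : ℝ) * (Fintype.card A : ℝ) / (8 * (T : ℝ)))) εopt c π out) :
    M.IsEpsOptimalTVAIL D ε out := by
  have : Nonempty (TVAIL.Policy H S A) := ⟨out⟩
  obtain ⟨_, ⟨π', rfl⟩, h_min⟩ := M.exists_isLeast_tvLoss D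
  refine ⟨_, ⟨⟨π', rfl⟩, h_min⟩, ?_⟩
  obtain rfl | hH := H.eq_zero_or_pos
  · simpa [TVAIL.MDP.tvLoss] using hε.le
  have h_card : (0 : ℝ) < Fintype.card S * Fintype.card A := by
    have := TVAIL.nonempty_of_mem_stdSimplex (M.occ_mem_stdSimplex out ⟨0, hH⟩)
    exact_mod_cast (Fintype.card_prod S A).symm ▸ Fintype.card_pos
  have hH' : (0 : ℝ) < H := by exact_mod_cast hH
  have hT' : (0 : ℝ) < T := lt_of_lt_of_le (by positivity) hT
  have h_loss := hrun.tvLoss_le hN (by exact_mod_cast hT') (by positivity) π'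
  have h_rate := TVAIL.average_regret_bound_le h_card hH' hT' hε hT
  linarith

theorem mainTheorem9 :
    ∃ C : ℝ, 0 < C ∧
      ∀ (S A : Type*) [Fintype S] [Fintype A] [DecidableEq S] [DecidableEq A]
        (H N T : ℕ) (M : TVAIL.MDP H S A) (D : Fin N → TVAIL.Traj H S A) (ε εopt : ℝ)
        (c : ℕ → TVAIL.Cost H S A) (π : ℕ → TVAIL.Policy H S A) (out : TVAIL.Policy H S A),
        0 < N → 0 < ε → ε < (H : ℝ) → εopt ≤ ε / 2 →
        C * ((Fintype.card S : ℝ) * (Fintype.card A : ℝ) * (H : ℝ) ^ 2 / ε ^ 2) ≤ (T : ℝ) →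
        M.IsTVAILRun D T
          (fun _ => √((Fintype.card S : ℝ) * (Fintype.card A : ℝ) / (8 * (T : ℝ)))) εopt c π out →
        M.IsEpsOptimalTVAIL D ε out :=
  ⟨289 / 2, by norm_num, fun _ _ _ _ _ _ _ _ _ _ _ _ _ _ _ _ hN hε _ hopt hT hrun =>
    mainTheorem9_general hN hε hopt hT hrun⟩
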